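/- Let $X$ be a Polish space (a separable topological space that can be metrized by a complete distance), let $\mathcal M_+^1(X)$ be the set of Borel probability measures on $X$, and let $p\ge 1$ be a real number. Let $d:X\times X\to[0,\infty)$ be a distance on $X$, that is, $d(x,y)=d(y,x)\ge 0$, $d(x,y)=0$ if and only if $x=y$, and $d(x,z)\le d(x,y)+d(y,z)$ for all $x,y,z\in X$. Assume that $d$ is lower semicontinuous on $X\times X$ (this holds in particular if $d$ induces the topology of $X$, and for the $0/1$ distance). For $\alpha,\beta\in\mathcal M_+^1(X)$ let $\mathcal U(\alpha,\beta)$ be the set of probability measures $\pi$ on $X\times X$ whose first and second marginals are $\alpha$ and $\beta$, and put $$\mathrm{MK}_{d^p}(\alpha,\beta)=\inf_{\pi\in\mathcal U(\alpha,\beta)}\int_{X\times X} d(x,y)^p\,\mathrm d\pi(x,y)\in[0,\infty],\qquad W_p(\alpha,\beta)=\mathrm{MK}_{d^p}(\alpha,\beta)^{1/p}\in[0,\infty].$$ Then the infimum is attained, i.e. it is a minimum, and $W_p$ is a distance on probability measures: for all $\alpha,\beta,\gamma\in\mathcal M_+^1(X)$, 1. $W_p(\alpha,\beta)=W_p(\beta,\alpha)$;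 2. $W_p(\alpha,\beta)=0$ if and only if $\alpha=\beta$; 3. $W_p(\alpha,\gamma)\le W_p(\alpha,\beta)+W_p(\beta,\gamma)$; 4. $W_p(\alpha,\beta)<\infty$ whenever $\alpha$ and $\beta$ have a finite moment of order $p$, i.e. whenever $\int_X d(x_0,x)^p\,\mathrm d\alpha(x)<\infty$ for some $x_0\in X$ and $\int_X d(y_0,x)^p\,\mathrm d\beta(x)<\infty$ for some $y_0\in X$. In particular $W_p$ is a finite distance on the set of probability measures with finite moment of order $p$, which is all of $\mathcal M_+^1(X)$ if $d$ is bounded. -/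

import Mathlib

open MeasureTheory
open scoped ENNReal

namespace OptimalTransport

/-- A distance on a set `X`, as a real-valued function of two variables. It is kept separate from
the topology of `X`, which need not be the one that the distance induces. -/
structure IsDistance {X : Type*} (d : X → X → ℝ) : Prop where
  symm : ∀ x y, d x y = d y x
  nonneg : ∀ x y, 0 ≤ d x y
  eq_zero_iff : ∀ x y, d x y = 0 ↔ x = y
  triangle : ∀ x y z, d x z ≤ d x y + d y z

/-- The couplings of `α` and `β`: the probability measures on `X × Y` with marginals `α`, `β`. -/
def couplings {X Y : Type*} [MeasurableSpace X] [MeasurableSpace Y]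
    (α : ProbabilityMeasure X) (β : ProbabilityMeasure Y) : Set (ProbabilityMeasure (X × Y)) :=
  {π | (π : Measure (X × Y)).map Prod.fst = (α : Measure X) ∧
    (π : Measure (X × Y)).map Prod.snd = (β : Measure Y)}

/-- The total cost `∫ c(x, y) dπ(x, y)` of a coupling, for a nonnegative cost. -/
noncomputable def transportCost {X Y : Type*} [MeasurableSpace X] [MeasurableSpace Y]
    (c : X → Y → ℝ≥0∞) (π : ProbabilityMeasure (X × Y)) : ℝ≥0∞ :=
  ∫⁻ z, c z.1 z.2 ∂(π : Measure (X × Y))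

/-- The Monge–Kantorovich value: the least cost of a coupling of `α` and `β`. -/
noncomputable def MK {X Y : Type*} [MeasurableSpace X] [MeasurableSpace Y]
    (c : X → Y → ℝ≥0∞) (α : ProbabilityMeasure X) (β : ProbabilityMeasure Y) : ℝ≥0∞ :=
  ⨅ π ∈ couplings α β, transportCost c π

/-- The cost `d(x, y) ^ p`. -/
noncomputable def distPow {X : Type*} (d : X → X → ℝ) (p : ℝ) (x y : X) : ℝ≥0∞ :=
  ENNReal.ofReal (d x y ^ p)

/-- The `p`-Wasserstein distance `MK_{d^p}(α, β)^{1/p}`, with values in `[0, ∞]`. -/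
noncomputable def wasserstein {X : Type*} [MeasurableSpace X] (d : X → X → ℝ) (p : ℝ)
    (α β : ProbabilityMeasure X) : ℝ≥0∞ :=
  MK (distPow d p) α β ^ (1 / p)

/-- `α` has a finite moment of order `p` for `d`. -/
def HasFiniteMoment {X : Type*} [MeasurableSpace X] (d : X → X → ℝ) (p : ℝ)
    (α : ProbabilityMeasure X) : Prop :=
  ∃ x₀ : X, ∫⁻ x, distPow d p x₀ x ∂(α : Measure X) < ∞

end OptimalTransport

/-!
By Prokhorov's theorem the couplings of two given measures form a compact set, and the layer cake
formula together with the portmanteau theorem makes the cost a lower semicontinuous function of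
the coupling, so the minimum is attained. A minimizer of zero cost is carried by the diagonal,
which gives definiteness. The triangle inequality is Minkowski's inequality in `L^p` of a measure on
the triple product that glues a coupling of `α, β` and one of `β, γ` along `β`. Finiteness is the
triangle inequality through two point masses, as the moment of `β` at `x` is the cost of
transporting the point mass at `x` to `β`.
-/

namespace OptimalTransport

open Filter Topology ProbabilityTheory

section MongeKantorovich

variable {X Y Z : Type*} [MeasurableSpace X] [MeasurableSpace Y] [MeasurableSpace Z]
  {α : ProbabilityMeasure X} {β : ProbabilityMeasure Y} {γ : ProbabilityMeasure Z}

theorem couplings_nonempty (α : ProbabilityMeasure X) (β : ProbabilityMeasure Y) :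
    (couplings α β).Nonempty :=
  ⟨α.prod β, by constructor <;> simp⟩

theorem hasLaw_fst_of_mem_couplings {π : ProbabilityMeasure (X × Y)} (hπ : π ∈ couplings α β) :
    HasLaw Prod.fst (α : Measure X) (π : Measure (X × Y)) :=
  ⟨measurable_fst.aemeasurable, hπ.1⟩

theorem hasLaw_snd_of_mem_couplings {π : ProbabilityMeasure (X × Y)} (hπ : π ∈ couplings α β) :
    HasLaw Prod.snd (β : Measure Y) (π : Measure (X × Y)) :=
  ⟨measurable_snd.aemeasurable, hπ.2⟩

theorem MK_le_lintegral_of_hasLaw (c : X → Y → ℝ≥0∞) {Ω : Type*} [MeasurableSpace Ω]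
    {P : Measure Ω} {f : Ω → X} {g : Ω → Y} (hf : HasLaw f (α : Measure X) P)
    (hg : HasLaw g (β : Measure Y) P) : MK c α β ≤ ∫⁻ ω, c (f ω) (g ω) ∂P := by
  have : IsProbabilityMeasure P := hf.isProbabilityMeasure
  have hfg : AEMeasurable (fun ω => (f ω, g ω)) P := hf.aemeasurable.prodMk hg.aemeasurable
  let π : ProbabilityMeasure (X × Y) :=
    ⟨P.map fun ω => (f ω, g ω), Measure.isProbabilityMeasure_map hfg⟩
  have hπ : π ∈ couplings α β :=
    ⟨(Measure.fst_map_prodMk₀ hg.aemeasurable).trans hf.map_eq,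
      (Measure.snd_map_prodMk₀ hf.aemeasurable).trans hg.map_eq⟩
  exact (iInf₂_le π hπ).trans (lintegral_map_le (fun z : X × Y => c z.1 z.2) _)

theorem MK_flip (c : X → Y → ℝ≥0∞) (α : ProbabilityMeasure X) (β : ProbabilityMeasure Y) :
    MK (fun y x => c x y) β α = MK c α β :=
  le_antisymm
    (le_iInf₂ fun _ hπ => MK_le_lintegral_of_hasLaw _ (hasLaw_snd_of_mem_couplings hπ)
      (hasLaw_fst_of_mem_couplings hπ))
    (le_iInf₂ fun _ hπ => MK_le_lintegral_of_hasLaw _ (hasLaw_snd_of_mem_couplings hπ)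
      (hasLaw_fst_of_mem_couplings hπ))

theorem MK_self_eq_zero {c : X → X → ℝ≥0∞} (hc : ∀ x, c x x = 0) (α : ProbabilityMeasure X) :
    MK c α α = 0 :=
  nonpos_iff_eq_zero.1 <| (MK_le_lintegral_of_hasLaw c HasLaw.id HasLaw.id).trans_eq <| by
    simp only [id_eq, hc, lintegral_zero]

theorem MK_dirac_left_le (c : X → Y → ℝ≥0∞) (x : X) (β : ProbabilityMeasure Y) :
    MK c (diracProba x) β ≤ ∫⁻ y, c x y ∂(β : Measure Y) :=
  MK_le_lintegral_of_hasLaw c (hasLaw_dirac_of_ae_eq (ae_eq_refl _)) HasLaw.id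

theorem MK_dirac_dirac_le (c : X → Y → ℝ≥0∞) (x : X) (y : Y) :
    MK c (diracProba x) (diracProba y) ≤ c x y := by
  simpa using MK_le_lintegral_of_hasLaw c (α := diracProba x) (β := diracProba y)
    (P := Measure.dirac ()) (hasLaw_dirac_of_ae_eq (ae_eq_refl _))
    (hasLaw_dirac_of_ae_eq (ae_eq_refl _))

theorem eq_of_transportCost_eq_zero {c : X → X → ℝ≥0∞} (hc : ∀ x y, c x y = 0 → x = y)
    (hm : Measurable fun z : X × X => c z.1 z.2) {α β : ProbabilityMeasure X}
    {π : ProbabilityMeasure (X × X)} (hπ : π ∈ couplings α β) (h : transportCost c π = 0) :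
    α = β := by
  have diagonal : Prod.fst =ᵐ[(π : Measure (X × X))] Prod.snd :=
    ((lintegral_eq_zero_iff hm).1 h).mono fun z hz => hc z.1 z.2 hz
  exact Subtype.ext (hπ.1.symm.trans ((Measure.map_congr diagonal).trans hπ.2))

theorem exists_gluing [StandardBorelSpace Z] [Nonempty Z] {π : Measure (X × Y)} [SFinite π]
    {ρ : Measure (Y × Z)} [IsFiniteMeasure ρ] (h : π.snd = ρ.fst) :
    ∃ σ : Measure ((X × Y) × Z),
      HasLaw Prod.fst π σ ∧ HasLaw (fun z : (X × Y) × Z => (z.1.2, z.2)) ρ σ := by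
  -- Under `σ`, the third coordinate is drawn from the second one alone, by the conditional law.
  let σ : Measure ((X × Y) × Z) := π ⊗ₘ ρ.condKernel.comap Prod.snd measurable_snd
  have hm : Measurable fun z : (X × Y) × Z => (z.1.2, z.2) := by fun_prop
  have map_eq_compProd : σ.map (fun z => (z.1.2, z.2)) = π.snd ⊗ₘ ρ.condKernel := by
    ext s hs
    rw [Measure.map_apply hm hs, Measure.compProd_apply hs, Measure.snd,
      lintegral_map (Kernel.measurable_kernel_prodMk_left hs) measurable_snd]
    exact Measure.compProd_apply (hm hs)
  refine ⟨σ, ⟨measurable_fst.aemeasurable, Measure.fst_compProd _ _⟩, ⟨hm.aemeasurable, ?_⟩⟩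
  rw [map_eq_compProd, h, ρ.disintegrate ρ.condKernel]

section Triangle

variable [StandardBorelSpace Z] {c₁₂ : X → Y → ℝ≥0∞} {c₂₃ : Y → Z → ℝ≥0∞} {c₁₃ : X → Z → ℝ≥0∞}
  {p : ℝ}

theorem MK_rpow_le_transportCost_add (h₁₂ : Measurable fun z : X × Y => c₁₂ z.1 z.2)
    (h₂₃ : Measurable fun z : Y × Z => c₂₃ z.1 z.2)
    (h : ∀ x y z, c₁₃ x z ≤ c₁₂ x y + c₂₃ y z) (hp : 1 ≤ p) {π : ProbabilityMeasure (X × Y)}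
    {ρ : ProbabilityMeasure (Y × Z)} (hπ : π ∈ couplings α β) (hρ : ρ ∈ couplings β γ) :
    MK (fun x z => c₁₃ x z ^ p) α γ ^ (1 / p) ≤
      transportCost (fun x y => c₁₂ x y ^ p) π ^ (1 / p) +
        transportCost (fun y z => c₂₃ y z ^ p) ρ ^ (1 / p) := by
  have : Nonempty Z := γ.nonempty
  obtain ⟨σ, hσπ, hσρ⟩ := exists_gluing (hπ.2.trans hρ.1.symm)
  have hσα := (hasLaw_fst_of_mem_couplings hπ).comp hσπ
  have hσγ := (hasLaw_snd_of_mem_couplings hρ).comp hσρ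
  calc MK (fun x z => c₁₃ x z ^ p) α γ ^ (1 / p)
      ≤ (∫⁻ z, c₁₃ z.1.1 z.2 ^ p ∂σ) ^ (1 / p) := by
        gcongr
        exact MK_le_lintegral_of_hasLaw _ hσα hσγ
    _ ≤ (∫⁻ z, (c₁₂ z.1.1 z.1.2 + c₂₃ z.1.2 z.2) ^ p ∂σ) ^ (1 / p) := by
        gcongr with z
        exact h z.1.1 z.1.2 z.2
    _ ≤ (∫⁻ z, c₁₂ z.1.1 z.1.2 ^ p ∂σ) ^ (1 / p) + (∫⁻ z, c₂₃ z.1.2 z.2 ^ p ∂σ) ^ (1 / p) :=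
        ENNReal.lintegral_Lp_add_le (h₁₂.comp measurable_fst).aemeasurable
          (h₂₃.comp (by fun_prop : Measurable fun z : (X × Y) × Z => (z.1.2, z.2))).aemeasurable hp
    _ = _ := by
        rw [transportCost, transportCost, ← hσπ.lintegral_comp (h₁₂.pow_const p).aemeasurable,
          ← hσρ.lintegral_comp (h₂₃.pow_const p).aemeasurable]

theorem MK_rpow_eq_iInf (c : X → Y → ℝ≥0∞) (α : ProbabilityMeasure X) (β : ProbabilityMeasure Y)
    {q : ℝ} (hq : 0 < q) : MK c α β ^ q = ⨅ π ∈ couplings α β, transportCost c π ^ q := by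
  simp only [MK, ← ENNReal.orderIsoRpow_apply q hq, OrderIso.map_iInf]

theorem MK_rpow_triangle (h₁₂ : Measurable fun z : X × Y => c₁₂ z.1 z.2)
    (h₂₃ : Measurable fun z : Y × Z => c₂₃ z.1 z.2)
    (h : ∀ x y z, c₁₃ x z ≤ c₁₂ x y + c₂₃ y z) (hp : 1 ≤ p) (α : ProbabilityMeasure X)
    (β : ProbabilityMeasure Y) (γ : ProbabilityMeasure Z) :
    MK (fun x z => c₁₃ x z ^ p) α γ ^ (1 / p) ≤
      MK (fun x y => c₁₂ x y ^ p) α β ^ (1 / p) + MK (fun y z => c₂₃ y z ^ p) β γ ^ (1 / p) := by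
  have hp_inv : 0 < 1 / p := by positivity
  rw [MK_rpow_eq_iInf _ α β hp_inv, MK_rpow_eq_iInf _ β γ hp_inv]
  exact ENNReal.le_iInf₂_add_iInf₂ fun π hπ ρ hρ =>
    MK_rpow_le_transportCost_add h₁₂ h₂₃ h hp hπ hρ

end Triangle

end MongeKantorovich

section LowerSemicontinuity

variable {Ω : Type*} [MeasurableSpace Ω]

theorem volume_restrict_Ioi_ofReal_lt (a : ℝ≥0∞) :
    volume.restrict (Set.Ioi 0) {t : ℝ | ENNReal.ofReal t < a} = a := by
  rw [Measure.restrict_apply (measurableSet_lt ENNReal.measurable_ofReal measurable_const)]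
  induction a with
  | top => simp
  | coe a =>
    have inter_eq_Ioo : {t : ℝ | ENNReal.ofReal t < a} ∩ Set.Ioi 0 = Set.Ioo 0 (a : ℝ) := by
      ext t
      rw [Set.inter_comm]
      refine and_congr_right fun ht => ?_
      rw [Set.mem_ofPred_eq, ← ENNReal.ofReal_coe_nnreal,
        ENNReal.ofReal_lt_ofReal_iff_of_nonneg ht.le]
    rw [inter_eq_Ioo, Real.volume_Ioo, sub_zero, ENNReal.ofReal_coe_nnreal]

theorem lintegral_eq_lintegral_measure_ofReal_lt {μ : Measure Ω} [SFinite μ] {f : Ω → ℝ≥0∞}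
    (hf : Measurable f) :
    ∫⁻ x, f x ∂μ = ∫⁻ t in Set.Ioi (0 : ℝ), μ {x | ENNReal.ofReal t < f x} := by
  have measurable_hypograph : MeasurableSet {z : Ω × ℝ | ENNReal.ofReal z.2 < f z.1} :=
    measurableSet_lt (by fun_prop) (by fun_prop)
  calc ∫⁻ x, f x ∂μ
      = (μ.prod (volume.restrict (Set.Ioi 0))) {z : Ω × ℝ | ENNReal.ofReal z.2 < f z.1} := by
        rw [Measure.prod_apply measurable_hypograph]
        exact lintegral_congr fun x => (volume_restrict_Ioi_ofReal_lt (f x)).symm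
    _ = ∫⁻ t in Set.Ioi (0 : ℝ), μ {x | ENNReal.ofReal t < f x} :=
        Measure.prod_apply_symm measurable_hypograph

theorem lowerSemicontinuous_lintegral [TopologicalSpace Ω] [OpensMeasurableSpace Ω]
    [HasOuterApproxClosed Ω] [FirstCountableTopology (ProbabilityMeasure Ω)] {f : Ω → ℝ≥0∞}
    (hf : LowerSemicontinuous f) :
    LowerSemicontinuous fun μ : ProbabilityMeasure Ω => ∫⁻ x, f x ∂(μ : Measure Ω) := by
  rw [lowerSemicontinuous_iff_le_liminf]
  intro μ
  simp_rw [lintegral_eq_lintegral_measure_ofReal_lt hf.measurable]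
  calc ∫⁻ t in Set.Ioi (0 : ℝ), (μ : Measure Ω) {x | ENNReal.ofReal t < f x}
      ≤ ∫⁻ t in Set.Ioi (0 : ℝ),
          liminf (fun ν : ProbabilityMeasure Ω => (ν : Measure Ω) {x | ENNReal.ofReal t < f x})
            (𝓝 μ) :=
        lintegral_mono fun t => ProbabilityMeasure.le_liminf_measure_open_of_tendsto tendsto_id
          (hf.isOpen_preimage (ENNReal.ofReal t))
    _ ≤ _ := lintegral_liminf_le fun ν => Antitone.measurable fun s t hst =>
        measure_mono fun x hx => (ENNReal.ofReal_le_ofReal hst).trans_lt hx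

end LowerSemicontinuity

section OptimalCoupling

variable {X Y : Type*} [TopologicalSpace X] [MeasurableSpace X] [TopologicalSpace Y]
  [MeasurableSpace Y]

theorem isClosed_couplings [BorelSpace X] [HasOuterApproxClosed X] [BorelSpace Y]
    [HasOuterApproxClosed Y] [OpensMeasurableSpace (X × Y)] (α : ProbabilityMeasure X)
    (β : ProbabilityMeasure Y) : IsClosed (couplings α β) := by
  have couplings_eq : couplings α β = {π : ProbabilityMeasure (X × Y) |
      π.map measurable_fst.aemeasurable = α ∧ π.map measurable_snd.aemeasurable = β} := by
    ext π
    simp only [couplings, Set.mem_ofPred_eq, ← ProbabilityMeasure.toMeasure_injective.eq_iff,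
      ProbabilityMeasure.toMeasure_map]
  rw [couplings_eq]
  exact (isClosed_eq (ProbabilityMeasure.continuous_map continuous_fst) continuous_const).inter
    (isClosed_eq (ProbabilityMeasure.continuous_map continuous_snd) continuous_const)

variable [PolishSpace X] [BorelSpace X] [PolishSpace Y] [BorelSpace Y]

theorem isCompact_couplings (α : ProbabilityMeasure X) (β : ProbabilityMeasure Y) :
    IsCompact (couplings α β) := by
  rw [← (isClosed_couplings α β).closure_eq]
  refine isCompact_closure_of_isTightMeasureSet (IsTightMeasureSet.prodMk ?_ ?_)
  · refine (isTightMeasureSet_singleton (μ := (α : Measure X))).subset ?_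
    rintro _ ⟨_, ⟨π, hπ, rfl⟩, rfl⟩
    exact hπ.1
  · refine (isTightMeasureSet_singleton (μ := (β : Measure Y))).subset ?_
    rintro _ ⟨_, ⟨π, hπ, rfl⟩, rfl⟩
    exact hπ.2

theorem exists_transportCost_eq_MK {c : X → Y → ℝ≥0∞}
    (hc : LowerSemicontinuous fun z : X × Y => c z.1 z.2) (α : ProbabilityMeasure X)
    (β : ProbabilityMeasure Y) : ∃ π ∈ couplings α β, transportCost c π = MK c α β := by
  have lsc_transportCost : LowerSemicontinuous (transportCost c) :=
    lowerSemicontinuous_lintegral hc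
  obtain ⟨π, hπ, hmin⟩ := (lsc_transportCost.lowerSemicontinuousOn _).exists_isMinOn
    (couplings_nonempty α β) (isCompact_couplings α β)
  exact ⟨π, hπ, le_antisymm (le_iInf₂ fun ρ hρ => hmin hρ) (iInf₂_le π hπ)⟩

end OptimalCoupling

section Wasserstein

variable {X : Type*} {d : X → X → ℝ} {p : ℝ}

theorem distPow_eq_ofReal_rpow (hd : ∀ x y, 0 ≤ d x y) (hp : 0 ≤ p) (x y : X) :
    distPow d p x y = ENNReal.ofReal (d x y) ^ p :=
  (ENNReal.ofReal_rpow_of_nonneg (hd x y) hp).symm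

theorem distPow_eq_zero_iff (hd : IsDistance d) (hp : 0 < p) {x y : X} :
    distPow d p x y = 0 ↔ x = y := by
  rw [distPow_eq_ofReal_rpow hd.nonneg hp.le, ENNReal.rpow_eq_zero_iff_of_pos hp,
    ENNReal.ofReal_eq_zero, (hd.nonneg x y).ge_iff_eq', hd.eq_zero_iff]

theorem lowerSemicontinuous_distPow [TopologicalSpace X] (hd : ∀ x y, 0 ≤ d x y)
    (hlsc : LowerSemicontinuous fun z : X × X => d z.1 z.2) (hp : 0 ≤ p) :
    LowerSemicontinuous fun z : X × X => distPow d p z.1 z.2 := by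
  simp only [distPow_eq_ofReal_rpow hd hp]
  exact (ENNReal.continuous_rpow_const.comp ENNReal.continuous_ofReal).comp_lowerSemicontinuous
    hlsc ((ENNReal.monotone_rpow_of_nonneg hp).comp ENNReal.ofReal_mono)

theorem wasserstein_comm [MeasurableSpace X] (hd : ∀ x y, d x y = d y x)
    (α β : ProbabilityMeasure X) : wasserstein d p α β = wasserstein d p β α := by
  have distPow_comm : distPow d p = fun x y => distPow d p y x := by
    funext x y
    rw [distPow, distPow, hd]
  rw [wasserstein, distPow_comm, MK_flip, wasserstein]

theorem wasserstein_eq_zero_iff [TopologicalSpace X] [PolishSpace X] [MeasurableSpace X]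
    [BorelSpace X] (hd : IsDistance d) (hlsc : LowerSemicontinuous fun z : X × X => d z.1 z.2)
    (hp : 0 < p) {α β : ProbabilityMeasure X} : wasserstein d p α β = 0 ↔ α = β := by
  have hlsc_pow := lowerSemicontinuous_distPow hd.nonneg hlsc hp.le
  rw [wasserstein, ENNReal.rpow_eq_zero_iff_of_pos (by positivity)]
  constructor
  · intro h
    obtain ⟨π, hπ, hcost⟩ := exists_transportCost_eq_MK hlsc_pow α β
    exact eq_of_transportCost_eq_zero (fun _ _ => (distPow_eq_zero_iff hd hp).1)
      hlsc_pow.measurable hπ (hcost.trans h)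
  · rintro rfl
    exact MK_self_eq_zero (fun _ => (distPow_eq_zero_iff hd hp).2 rfl) α

variable [MeasurableSpace X]

theorem wasserstein_triangle [StandardBorelSpace X] (hd : IsDistance d)
    (hm : Measurable fun z : X × X => d z.1 z.2) (hp : 1 ≤ p) (α β γ : ProbabilityMeasure X) :
    wasserstein d p α γ ≤ wasserstein d p α β + wasserstein d p β γ := by
  have distPow_eq : distPow d p = fun x y => ENNReal.ofReal (d x y) ^ p :=
    funext₂ (distPow_eq_ofReal_rpow hd.nonneg (zero_le_one.trans hp))
  simp only [wasserstein, distPow_eq]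
  refine MK_rpow_triangle hm.ennreal_ofReal hm.ennreal_ofReal (fun x y z => ?_) hp α β γ
  rw [← ENNReal.ofReal_add (hd.nonneg x y) (hd.nonneg y z)]
  exact ENNReal.ofReal_le_ofReal (hd.triangle x y z)

theorem wasserstein_dirac_dirac_lt_top (hp : 0 ≤ p) (x y : X) :
    wasserstein d p (diracProba x) (diracProba y) < ∞ :=
  ENNReal.rpow_lt_top_of_nonneg (by positivity)
    ((MK_dirac_dirac_le _ x y).trans_lt ENNReal.ofReal_lt_top).ne

theorem HasFiniteMoment.exists_wasserstein_dirac_lt_top (hp : 0 ≤ p) {α : ProbabilityMeasure X}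
    (hα : HasFiniteMoment d p α) : ∃ x : X, wasserstein d p (diracProba x) α < ∞ :=
  hα.imp fun x hx => ENNReal.rpow_lt_top_of_nonneg (by positivity)
    ((MK_dirac_left_le _ x α).trans_lt hx).ne

theorem wasserstein_lt_top [StandardBorelSpace X] (hd : IsDistance d)
    (hm : Measurable fun z : X × X => d z.1 z.2) (hp : 1 ≤ p) {α β : ProbabilityMeasure X}
    (hα : HasFiniteMoment d p α) (hβ : HasFiniteMoment d p β) : wasserstein d p α β < ∞ := by
  have hp₀ : 0 ≤ p := zero_le_one.trans hp
  obtain ⟨x, hx⟩ := hα.exists_wasserstein_dirac_lt_top hp₀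
  obtain ⟨y, hy⟩ := hβ.exists_wasserstein_dirac_lt_top hp₀
  calc wasserstein d p α β
      ≤ wasserstein d p α (diracProba x) + wasserstein d p (diracProba x) β :=
        wasserstein_triangle hd hm hp _ _ _
    _ ≤ wasserstein d p (diracProba x) α +
          (wasserstein d p (diracProba x) (diracProba y) + wasserstein d p (diracProba y) β) := by
        rw [wasserstein_comm hd.symm α]
        gcongr
        exact wasserstein_triangle hd hm hp _ _ _
    _ < ∞ := ENNReal.add_lt_top.2
        ⟨hx, ENNReal.add_lt_top.2 ⟨wasserstein_dirac_dirac_lt_top hp₀ x y, hy⟩⟩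

end Wasserstein

end OptimalTransport

theorem mainTheorem4 {X : Type*} [TopologicalSpace X] [PolishSpace X] [MeasurableSpace X]
    [BorelSpace X] (d : X → X → ℝ) (hd : OptimalTransport.IsDistance d)
    (hlsc : LowerSemicontinuous (fun z : X × X => d z.1 z.2)) (p : ℝ) (hp : 1 ≤ p) :
    -- the minimum that defines `MK` is attained
    (∀ α β : ProbabilityMeasure X, ∃ π ∈ OptimalTransport.couplings α β,
      OptimalTransport.transportCost (OptimalTransport.distPow d p) π =
        OptimalTransport.MK (OptimalTransport.distPow d p) α β) ∧
    -- symmetry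
    (∀ α β : ProbabilityMeasure X,
      OptimalTransport.wasserstein d p α β = OptimalTransport.wasserstein d p β α) ∧
    -- definiteness
    (∀ α β : ProbabilityMeasure X, OptimalTransport.wasserstein d p α β = 0 ↔ α = β) ∧
    -- triangle inequality
    (∀ α β γ : ProbabilityMeasure X,
      OptimalTransport.wasserstein d p α γ ≤
        OptimalTransport.wasserstein d p α β + OptimalTransport.wasserstein d p β γ) ∧
    -- finiteness on the measures with a finite moment of order `p`
    (∀ α β : ProbabilityMeasure X, OptimalTransport.HasFiniteMoment d p α →
      OptimalTransport.HasFiniteMoment d p β → OptimalTransport.wasserstein d p α β < ∞) := by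
  open OptimalTransport in
  have hp₀ : 0 < p := zero_lt_one.trans_le hp
  exact ⟨exists_transportCost_eq_MK (lowerSemicontinuous_distPow hd.nonneg hlsc hp₀.le),
    wasserstein_comm hd.symm,
    fun _ _ => wasserstein_eq_zero_iff hd hlsc hp₀,
    wasserstein_triangle hd hlsc.measurable hp,
    fun _ _ => wasserstein_lt_top hd hlsc.measurable hp⟩
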